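/- Let $S$ be a simply connected solvable Lie group with Lie algebra $\mathfrak{s}$, endowed with a left-invariant Riemannian metric $g$. Let $\mathrm{Ric}$ be the Ricci operator of $g$, i.e. $g(\mathrm{Ric}\,\cdot,\cdot)$ is the Ricci tensor of the Levi-Civita connection of $g$; at the identity it is an endomorphism of $\mathfrak{s}$. Assume that $(S,g)$ is a solsoliton, that is, $\mathrm{Ric}=cI+D$ on $\mathfrak{s}$ for some $c\in\mathbb{R}$ and some derivation $D\in\mathrm{Der}(\mathfrak{s})$. (a) If $c\ge 0$, then $\mathrm{Ric}=0$ (on all of $S$). (b) If $g$ is not flat (its Riemann curvature tensor does not vanish identically), then $c<0$; that is, every nonflat solsoliton is expanding. -/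

import Mathlib

open scoped Manifold ContDiff

namespace LeftInvariant

noncomputable section

open Bundle VectorField

set_option linter.unusedSectionVars false

variable {E : Type*} [NormedAddCommGroup E] [NormedSpace ℝ E]
  {G : Type*} [TopologicalSpace G] [ChartedSpace E G] [Group G]

instance instLieGroupMinSmoothness [LieGroup 𝓘(ℝ, E) ∞ G] :
    LieGroup 𝓘(ℝ, E) (minSmoothness ℝ 3) G := by
  rw [minSmoothness_of_isRCLikeNormedField]; infer_instance

instance instFiniteDimensionalTangentSpace [FiniteDimensional ℝ E] (x : G) :
    FiniteDimensional ℝ (TangentSpace 𝓘(ℝ, E) x) :=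
  inferInstanceAs (FiniteDimensional ℝ E)

instance instT2SpaceTangentSpace (x : G) : T2Space (TangentSpace 𝓘(ℝ, E) x) :=
  inferInstanceAs (T2Space E)

/-- The differential at the identity of the left translation by `x`, as a map `𝔤 → T_x G`. -/
def fromIdentity (x : G) : GroupLieAlgebra 𝓘(ℝ, E) G →L[ℝ] TangentSpace 𝓘(ℝ, E) x :=
  mfderiv 𝓘(ℝ, E) 𝓘(ℝ, E) (x * ·) (1 : G)

/-- The inverse of the differential at the identity of the left translation by `x`, as a map
`T_x G → 𝔤` (the left-invariant Maurer-Cartan form). -/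
def toIdentity (x : G) : TangentSpace 𝓘(ℝ, E) x →L[ℝ] GroupLieAlgebra 𝓘(ℝ, E) G :=
  (fromIdentity x).inverse

lemma fromIdentity_apply (x : G) (v : GroupLieAlgebra 𝓘(ℝ, E) G) :
    fromIdentity x v = mulInvariantVectorField v x := rfl

/-- The left-invariant vector field on `G` with value `v` at the point `x`. -/
def leftInvExt {x : G} (v : TangentSpace 𝓘(ℝ, E) x) : Π y : G, TangentSpace 𝓘(ℝ, E) y :=
  mulInvariantVectorField (toIdentity x v)

variable (E G) in
/-- A smooth Riemannian metric on the Lie group `G` which is invariant under all left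
translations. -/
structure LeftInvariantMetric [LieGroup 𝓘(ℝ, E) ∞ G] extends
    ContMDiffRiemannianMetric 𝓘(ℝ, E) ∞ E (fun x : G ↦ TangentSpace 𝓘(ℝ, E) x) where
  leftInvariant : ∀ (a x : G) (v w : TangentSpace 𝓘(ℝ, E) x),
    inner (a * x) (mfderiv 𝓘(ℝ, E) 𝓘(ℝ, E) (a * ·) x v) (mfderiv 𝓘(ℝ, E) 𝓘(ℝ, E) (a * ·) x w) =
      inner x v w

variable [LieGroup 𝓘(ℝ, E) ∞ G]

lemma isInvertible_fromIdentity (x : G) :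
    (fromIdentity x : GroupLieAlgebra 𝓘(ℝ, E) G →L[ℝ] TangentSpace 𝓘(ℝ, E) x).IsInvertible := by
  let φ : G ≃ₘ^∞⟮𝓘(ℝ, E), 𝓘(ℝ, E)⟯ G :=
    { toEquiv := Equiv.mulLeft x
      contMDiff_toFun := contMDiff_mul_left
      contMDiff_invFun := contMDiff_mul_left (a := x⁻¹) }
  exact ⟨φ.mfderivToContinuousLinearEquiv (by simp) 1, rfl⟩

@[simp] lemma toIdentity_fromIdentity (x : G) (v : GroupLieAlgebra 𝓘(ℝ, E) G) :
    toIdentity x (fromIdentity x v) = v := by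
  obtain ⟨e, he⟩ := isInvertible_fromIdentity (E := E) x
  rw [toIdentity, ← he, ContinuousLinearMap.inverse_equiv]
  exact e.symm_apply_apply v

@[simp] lemma fromIdentity_toIdentity (x : G) (v : TangentSpace 𝓘(ℝ, E) x) :
    fromIdentity x (toIdentity x v) = v := by
  obtain ⟨e, he⟩ := isInvertible_fromIdentity (E := E) x
  rw [toIdentity, ← he, ContinuousLinearMap.inverse_equiv]
  exact e.apply_symm_apply v

lemma leftInvExt_self {x : G} (v : TangentSpace 𝓘(ℝ, E) x) : leftInvExt v x = v :=
  fromIdentity_toIdentity x v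

namespace LeftInvariantMetric

variable (g : LeftInvariantMetric E G)

lemma inner_fromIdentity (x : G) (v w : GroupLieAlgebra 𝓘(ℝ, E) G) :
    g.inner x (fromIdentity x v) (fromIdentity x w) = g.inner 1 v w := by
  have h := g.leftInvariant x 1 v w
  have key : ∀ y : G, y = x →
      g.inner y (fromIdentity (E := E) x v : E) (fromIdentity (E := E) x w : E) = g.inner 1 v w →
      g.inner x (fromIdentity x v) (fromIdentity x w) = g.inner 1 v w := by
    rintro y rfl h; exact h
  exact key _ (mul_one x) h

lemma inner_toIdentity (x : G) (v w : TangentSpace 𝓘(ℝ, E) x) :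
    g.inner 1 (toIdentity x v) (toIdentity x w) = g.inner x v w := by
  rw [← g.inner_fromIdentity x]; simp

/-- The inner product `g_x` on `T_x G`, as a bilinear form. -/
def form (x : G) : LinearMap.BilinForm ℝ (TangentSpace 𝓘(ℝ, E) x) :=
  LinearMap.mk₂ ℝ (fun v w ↦ g.inner x v w) (by simp) (by simp) (by simp) (by simp)

@[simp] lemma form_apply (x : G) (v w : TangentSpace 𝓘(ℝ, E) x) :
    g.form x v w = g.inner x v w := rfl

lemma form_nondegenerate (x : G) : (g.form x).Nondegenerate := by
  constructor
  · intro v hv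
    by_contra h
    exact (g.pos x v h).ne' (hv v)
  · intro v hv
    by_contra h
    exact (g.pos x v h).ne' (hv v)

lemma ext_inner {x : G} {v w : TangentSpace 𝓘(ℝ, E) x}
    (h : ∀ u, g.inner x v u = g.inner x w u) : v = w := by
  by_contra hne
  have h1 := g.pos x (v - w) (sub_ne_zero.2 hne)
  have h2 := h (v - w)
  simp only [map_sub, sub_apply] at h1 h2
  linarith

lemma mdifferentiableAt_inner {Y Z : Π x : G, TangentSpace 𝓘(ℝ, E) x} {x : G}
    (hY : MDiffAt (T% Y) x) (hZ : MDiffAt (T% Z) x) :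
    MDiffAt (fun y ↦ g.inner y (Y y) (Z y)) x := by
  have : MDifferentiableAt 𝓘(ℝ, E) (𝓘(ℝ, E).prod 𝓘(ℝ)) (fun m ↦ TotalSpace.mk' ℝ
      (E := Bundle.Trivial G ℝ) m (g.inner m (Y m) (Z m))) x := by
    apply MDifferentiableAt.clm_bundle_apply₂ (F₁ := E) (F₂ := E)
    · exact g.contMDiff.mdifferentiableAt (by simp)
    · exact hY
    · exact hZ
  simp only [mdifferentiableAt_totalSpace] at this
  exact this.2

variable [FiniteDimensional ℝ E]

/-- The vector `g_x`-dual to a linear form on `T_x G`. -/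
def sharp (x : G) :
    Module.Dual ℝ (TangentSpace 𝓘(ℝ, E) x) ≃ₗ[ℝ] TangentSpace 𝓘(ℝ, E) x :=
  ((g.form x).toDual (g.form_nondegenerate x)).symm

@[simp] lemma inner_sharp (x : G) (f : Module.Dual ℝ (TangentSpace 𝓘(ℝ, E) x))
    (v : TangentSpace 𝓘(ℝ, E) x) : g.inner x (g.sharp x f) v = f v :=
  LinearMap.BilinForm.apply_toDual_symm_apply (hB := g.form_nondegenerate x) f v

/-- The linear form `Z ↦ ½ (⟨[X, Y], Z⟩ - ⟨[Y, Z], X⟩ + ⟨[Z, X], Y⟩)`: the right-hand side of the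
Koszul formula for left-invariant vector fields. -/
def koszul (X Y : GroupLieAlgebra 𝓘(ℝ, E) G) : Module.Dual ℝ (GroupLieAlgebra 𝓘(ℝ, E) G) where
  toFun Z := (1 / 2 : ℝ) * (g.inner 1 ⁅X, Y⁆ Z - g.inner 1 ⁅Y, Z⁆ X + g.inner 1 ⁅Z, X⁆ Y)
  map_add' Z W := by simp only [lie_add, add_lie, map_add, add_apply]; ring
  map_smul' c Z := by
    simp only [lie_smul, smul_lie, map_smul, smul_apply, smul_eq_mul,
      RingHom.id_apply]
    ring

/-- The Levi-Civita connection on left-invariant vector fields, as a bilinear map `𝔤 × 𝔤 → 𝔤`. -/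
def nabla : GroupLieAlgebra 𝓘(ℝ, E) G →ₗ[ℝ] GroupLieAlgebra 𝓘(ℝ, E) G →ₗ[ℝ]
    GroupLieAlgebra 𝓘(ℝ, E) G :=
  LinearMap.mk₂ ℝ (fun X Y ↦ g.sharp 1 (g.koszul X Y))
    (fun X X' Y ↦ by
      rw [← map_add]; congr 1; ext Z
      simp only [koszul, lie_add, add_lie, map_add, add_apply,
        LinearMap.add_apply, LinearMap.coe_mk, AddHom.coe_mk]
      ring)
    (fun c X Y ↦ by
      rw [← map_smul]; congr 1; ext Z
      simp only [koszul, lie_smul, smul_lie, map_smul, smul_apply,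
        LinearMap.smul_apply, LinearMap.coe_mk, AddHom.coe_mk, smul_eq_mul]
      ring)
    (fun X Y Y' ↦ by
      rw [← map_add]; congr 1; ext Z
      simp only [koszul, lie_add, add_lie, map_add, add_apply,
        LinearMap.add_apply, LinearMap.coe_mk, AddHom.coe_mk]
      ring)
    (fun c X Y ↦ by
      rw [← map_smul]; congr 1; ext Z
      simp only [koszul, lie_smul, smul_lie, map_smul, smul_apply,
        LinearMap.smul_apply, LinearMap.coe_mk, AddHom.coe_mk, smul_eq_mul]
      ring)

lemma inner_nabla (X Y Z : GroupLieAlgebra 𝓘(ℝ, E) G) : g.inner 1 (g.nabla X Y) Z =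
    (1 / 2 : ℝ) * (g.inner 1 ⁅X, Y⁆ Z - g.inner 1 ⁅Y, Z⁆ X + g.inner 1 ⁅Z, X⁆ Y) :=
  g.inner_sharp 1 (g.koszul X Y) Z

lemma nabla_sub_nabla (X Y : GroupLieAlgebra 𝓘(ℝ, E) G) :
    g.nabla X Y - g.nabla Y X = ⁅X, Y⁆ := by
  refine g.ext_inner fun Z ↦ ?_
  rw [map_sub, sub_apply, inner_nabla, inner_nabla, ← lie_skew Y X,
    ← lie_skew Z X, ← lie_skew Z Y]
  simp only [map_neg, neg_apply]
  ring

lemma inner_nabla_add_inner_nabla (X Y Z : GroupLieAlgebra 𝓘(ℝ, E) G) :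
    g.inner 1 (g.nabla X Y) Z + g.inner 1 Y (g.nabla X Z) = 0 := by
  rw [g.symm 1 Y, inner_nabla, inner_nabla, ← lie_skew Z Y, ← lie_skew Z X, ← lie_skew Y X]
  simp only [map_neg, neg_apply]
  ring

variable (E G) in
/-- The chosen basis of the Lie algebra. -/
abbrev lieBasis : Module.Basis (Fin (Module.finrank ℝ (GroupLieAlgebra 𝓘(ℝ, E) G))) ℝ
    (GroupLieAlgebra 𝓘(ℝ, E) G) := Module.finBasis ℝ (GroupLieAlgebra 𝓘(ℝ, E) G)

/-- The `i`-th component of the vector field `Y` in the frame of left-invariant vector fields given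
by the chosen basis of the Lie algebra. -/
def component (i : Fin (Module.finrank ℝ (GroupLieAlgebra 𝓘(ℝ, E) G)))
    (Y : Π x : G, TangentSpace 𝓘(ℝ, E) x) (x : G) : ℝ :=
  (lieBasis E G).repr (toIdentity x (Y x)) i


lemma mdifferentiableAt_component (g : LeftInvariantMetric E G)
    (i : Fin (Module.finrank ℝ (GroupLieAlgebra 𝓘(ℝ, E) G)))
    {Y : Π x : G, TangentSpace 𝓘(ℝ, E) x} {x : G} (hY : MDiffAt (T% Y) x) :
    MDiffAt (component i Y) x := by
  have h : component i Y = fun y ↦ g.inner y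
      (mulInvariantVectorField (g.sharp 1 ((lieBasis E G).coord i)) y) (Y y) := by
    ext y
    rw [← g.inner_toIdentity, ← fromIdentity_apply, toIdentity_fromIdentity, inner_sharp]
    rfl
  rw [h]
  exact g.mdifferentiableAt_inner (mdifferentiableAt_mulInvariantVectorField _) hY

lemma component_mulInvariantVectorField
    (i : Fin (Module.finrank ℝ (GroupLieAlgebra 𝓘(ℝ, E) G))) (v : GroupLieAlgebra 𝓘(ℝ, E) G) :
    component i (mulInvariantVectorField v) = fun _ ↦ (lieBasis E G).repr v i := by
  ext x
  rw [component, ← fromIdentity_apply, toIdentity_fromIdentity]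

lemma component_add (i : Fin (Module.finrank ℝ (GroupLieAlgebra 𝓘(ℝ, E) G)))
    (Y Z : Π x : G, TangentSpace 𝓘(ℝ, E) x) :
    component i (Y + Z) = component i Y + component i Z := by
  ext x; simp [component]

lemma component_smul (i : Fin (Module.finrank ℝ (GroupLieAlgebra 𝓘(ℝ, E) G)))
    (f : G → ℝ) (Y : Π x : G, TangentSpace 𝓘(ℝ, E) x) :
    component i (f • Y) = f * component i Y := by
  ext x; simp [component]

lemma sum_component (Y : Π x : G, TangentSpace 𝓘(ℝ, E) x) (x : G) :
    ∑ i, component i Y x • fromIdentity x (lieBasis E G i) = Y x := by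
  simp only [component, ← map_smul, ← map_sum]
  rw [(lieBasis E G).sum_repr, fromIdentity_toIdentity]

/-- `u ↦ ∇_u V` on `T_x G`, where `V` is the left-invariant vector field given by `v`. -/
def nablaAt (v : GroupLieAlgebra 𝓘(ℝ, E) G) (x : G) :
    TangentSpace 𝓘(ℝ, E) x →L[ℝ] TangentSpace 𝓘(ℝ, E) x :=
  fromIdentity x ∘L (g.nabla.flip v).toContinuousLinearMap ∘L toIdentity x

lemma nablaAt_apply (v : GroupLieAlgebra 𝓘(ℝ, E) G) (x : G) (u : TangentSpace 𝓘(ℝ, E) x) :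
    g.nablaAt v x u = fromIdentity x (g.nabla (toIdentity x u) v) := rfl

/-- The Levi-Civita connection of `g`: writing a vector field as `Y = ∑ i, Yᵢ eᵢ` in a frame of
left-invariant vector fields, `∇_u Y = ∑ i, (dYᵢ(u) eᵢ + Yᵢ ∇_u eᵢ)`. -/
def leviCivita : CovariantDerivative 𝓘(ℝ, E) E (fun x : G ↦ TangentSpace 𝓘(ℝ, E) x) where
  toFun Y x := ∑ i, ((mvfderiv 𝓘(ℝ, E) (component i Y) x).smulRight
    (fromIdentity x (lieBasis E G i)) + component i Y x • g.nablaAt (lieBasis E G i) x)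
  isCovariantDerivativeOnUniv :=
    { add := by
        intro Y Z x hY hZ _
        rw [← Finset.sum_add_distrib]
        refine Finset.sum_congr rfl fun i _ ↦ ?_
        rw [component_add, mvfderiv_add (g.mdifferentiableAt_component i hY)
          (g.mdifferentiableAt_component i hZ)]
        ext u
        simp [add_smul]
        abel
      leibniz := by
        intro Y f x hY hf _
        rw [← sum_component Y x]
        ext u
        simp only [component_smul, mvfderiv_mul hf (g.mdifferentiableAt_component _ hY)]
        simp only [add_apply, sum_apply, smul_apply, ContinuousLinearMap.smulRight_apply,
          Pi.mul_apply, Finset.smul_sum, smul_eq_mul, ← Finset.sum_add_distrib]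
        refine Finset.sum_congr rfl fun i _ ↦ ?_
        module }

lemma leviCivita_apply (Y : Π x : G, TangentSpace 𝓘(ℝ, E) x) (x : G)
    (u : TangentSpace 𝓘(ℝ, E) x) : g.leviCivita Y x u =
      ∑ i, (mvfderiv 𝓘(ℝ, E) (component i Y) x u • fromIdentity x (lieBasis E G i) +
        component i Y x • fromIdentity x (g.nabla (toIdentity x u) (lieBasis E G i))) := by
  change (∑ i, ((mvfderiv 𝓘(ℝ, E) (component i Y) x).smulRight
    (fromIdentity x (lieBasis E G i)) + component i Y x • g.nablaAt (lieBasis E G i) x)) u = _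
  simp only [add_apply, sum_apply, smul_apply, ContinuousLinearMap.smulRight_apply, nablaAt_apply]

/-- On left-invariant vector fields, the Levi-Civita connection is given by `nabla`. -/
lemma leviCivita_mulInvariantVectorField (v : GroupLieAlgebra 𝓘(ℝ, E) G) (x : G)
    (u : TangentSpace 𝓘(ℝ, E) x) : g.leviCivita (mulInvariantVectorField v) x u =
      mulInvariantVectorField (g.nabla (toIdentity x u) v) x := by
  rw [leviCivita_apply]
  simp only [component_mulInvariantVectorField, mvfderiv_const, zero_apply, zero_smul, zero_add]
  conv_rhs => rw [← fromIdentity_apply, ← (lieBasis E G).sum_repr v]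
  simp only [map_sum, map_smul]

/-- The connection `leviCivita` is torsion-free. -/
theorem torsion_leviCivita : g.leviCivita.torsion = 0 := by
  ext x u v
  rw [← leftInvExt_self u, ← leftInvExt_self v]
  unfold leftInvExt
  rw [CovariantDerivative.torsion_apply g.leviCivita
    (mdifferentiableAt_mulInvariantVectorField _) (mdifferentiableAt_mulInvariantVectorField _)]
  rw [← mulInvariantVector_mlieBracket, ← GroupLieAlgebra.bracket_def,
    leviCivita_mulInvariantVectorField, leviCivita_mulInvariantVectorField]
  simp only [← fromIdentity_apply, fromIdentity_toIdentity, ← map_sub, nabla_sub_nabla]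
  simp

/-- The connection `leviCivita` is compatible with the metric. -/
theorem isMetricCompatible_leviCivita :
    letI : RiemannianBundle (fun x : G ↦ TangentSpace 𝓘(ℝ, E) x) := ⟨g.toRiemannianMetric⟩
    CovariantDerivative.IsMetricCompatible (V := fun x : G ↦ TangentSpace 𝓘(ℝ, E) x)
      g.leviCivita := by
  let _ : RiemannianBundle (fun x : G ↦ TangentSpace 𝓘(ℝ, E) x) := ⟨g.toRiemannianMetric⟩
  unfold CovariantDerivative.IsMetricCompatible
  ext x v w u
  obtain ⟨v, rfl⟩ : ∃ v', mulInvariantVectorField v' x = v := ⟨_, leftInvExt_self v⟩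
  obtain ⟨w, rfl⟩ : ∃ w', mulInvariantVectorField w' x = w := ⟨_, leftInvExt_self w⟩
  obtain ⟨u, rfl⟩ : ∃ u', mulInvariantVectorField u' x = u := ⟨_, leftInvExt_self u⟩
  have h := CovariantDerivative.derivMetricTensor_apply (V := fun x : G ↦ TangentSpace 𝓘(ℝ, E) x)
    g.leviCivita x (X := mulInvariantVectorField u)
    (mdifferentiableAt_mulInvariantVectorField v (g := x))
    (mdifferentiableAt_mulInvariantVectorField w (g := x))
  have hc : (fun y ↦ g.inner y (mulInvariantVectorField v y) (mulInvariantVectorField w y)) =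
      fun _ ↦ g.inner 1 v w := funext fun y ↦ g.inner_fromIdentity y v w
  have h1 : mvfderiv 𝓘(ℝ, E) (fun y ↦ g.inner y (mulInvariantVectorField v y)
      (mulInvariantVectorField w y)) x (mulInvariantVectorField u x) = 0 := by
    rw [hc, mvfderiv_const]; rfl
  have h2 : g.inner x (g.leviCivita (mulInvariantVectorField v) x (mulInvariantVectorField u x))
        (mulInvariantVectorField w x) +
      g.inner x (mulInvariantVectorField v x)
        (g.leviCivita (mulInvariantVectorField w) x (mulInvariantVectorField u x)) = 0 := by
    simp only [leviCivita_mulInvariantVectorField, ← fromIdentity_apply, inner_fromIdentity,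
      inner_nabla_add_inner_nabla]
  refine h.trans ?_
  change mvfderiv 𝓘(ℝ, E) (fun y ↦ g.inner y (mulInvariantVectorField v y)
      (mulInvariantVectorField w y)) x (mulInvariantVectorField u x) -
      g.inner x (g.leviCivita (mulInvariantVectorField v) x (mulInvariantVectorField u x))
        (mulInvariantVectorField w x) -
      g.inner x (mulInvariantVectorField v x)
        (g.leviCivita (mulInvariantVectorField w) x (mulInvariantVectorField u x)) = 0
  rw [h1]
  linarith
/-- The Riemann curvature tensor of `g` at `x`, computed on left-invariant extensions `U`, `V`, `W`
of the three vectors: `R(u, v) w = ∇_U ∇_V W - ∇_V ∇_U W - ∇_[U, V] W`. -/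
def curvature (x : G) (u v w : TangentSpace 𝓘(ℝ, E) x) : TangentSpace 𝓘(ℝ, E) x :=
  g.leviCivita (fun y ↦ g.leviCivita (leftInvExt w) y (leftInvExt v y)) x u -
    g.leviCivita (fun y ↦ g.leviCivita (leftInvExt w) y (leftInvExt u y)) x v -
    g.leviCivita (leftInvExt w) x (mlieBracket 𝓘(ℝ, E) (leftInvExt u) (leftInvExt v) x)

/-- The curvature tensor in terms of the bilinear map `nabla` on the Lie algebra. -/
lemma curvature_eq (x : G) (u v w : TangentSpace 𝓘(ℝ, E) x) :
    g.curvature x u v w = fromIdentity x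
      (g.nabla (toIdentity x u) (g.nabla (toIdentity x v) (toIdentity x w)) -
        g.nabla (toIdentity x v) (g.nabla (toIdentity x u) (toIdentity x w)) -
        g.nabla ⁅toIdentity x u, toIdentity x v⁆ (toIdentity x w)) := by
  have h (v w : TangentSpace 𝓘(ℝ, E) x) :
      (fun y ↦ g.leviCivita (leftInvExt w) y (leftInvExt v y)) =
        mulInvariantVectorField (g.nabla (toIdentity x v) (toIdentity x w)) := by
    ext y
    rw [leftInvExt, leftInvExt, leviCivita_mulInvariantVectorField, ← fromIdentity_apply y
      (toIdentity x v), toIdentity_fromIdentity]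
  rw [curvature, h, h, leftInvExt, leftInvExt, leftInvExt, leviCivita_mulInvariantVectorField,
    leviCivita_mulInvariantVectorField, ← mulInvariantVector_mlieBracket,
    leviCivita_mulInvariantVectorField, ← GroupLieAlgebra.bracket_def]
  simp only [← fromIdentity_apply, toIdentity_fromIdentity, map_sub]

/-- The endomorphism `u ↦ R(u, v) w` of `T_x G`. -/
def curvatureEnd (x : G) (v w : TangentSpace 𝓘(ℝ, E) x) :
    Module.End ℝ (TangentSpace 𝓘(ℝ, E) x) where
  toFun u := g.curvature x u v w
  map_add' u u' := by
    simp only [curvature_eq, map_add, map_sub, LinearMap.add_apply, add_lie]; abel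
  map_smul' c u := by
    simp only [curvature_eq, map_smul, map_sub, LinearMap.smul_apply, smul_lie, smul_sub,
      RingHom.id_apply]

/-- The Ricci tensor of `g` at `x`: `ric(v, w)` is the trace of `u ↦ R(u, v) w`. -/
def ricciTensor (x : G) : LinearMap.BilinForm ℝ (TangentSpace 𝓘(ℝ, E) x) :=
  LinearMap.mk₂ ℝ (fun v w ↦ LinearMap.trace ℝ _ (g.curvatureEnd x v w))
    (fun v v' w ↦ by
      rw [← map_add]; congr 1; ext u
      simp only [curvatureEnd, curvature_eq, map_add, map_sub, LinearMap.add_apply, lie_add,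
        LinearMap.coe_mk, AddHom.coe_mk]
      abel)
    (fun c v w ↦ by
      rw [← map_smul]; congr 1; ext u
      simp only [curvatureEnd, curvature_eq, map_smul, map_sub, LinearMap.smul_apply, lie_smul,
        LinearMap.coe_mk, AddHom.coe_mk, smul_sub])
    (fun v w w' ↦ by
      rw [← map_add]; congr 1; ext u
      simp only [curvatureEnd, curvature_eq, map_add, map_sub, LinearMap.add_apply,
        LinearMap.coe_mk, AddHom.coe_mk]
      abel)
    (fun c v w ↦ by
      rw [← map_smul]; congr 1; ext u
      simp only [curvatureEnd, curvature_eq, map_smul, map_sub, LinearMap.smul_apply,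
        LinearMap.coe_mk, AddHom.coe_mk, smul_sub])

/-- The Ricci operator of `g` at `x`, characterized by `g(Ric v, w) = ric(v, w)`. -/
def ricciOperator (x : G) : Module.End ℝ (TangentSpace 𝓘(ℝ, E) x) :=
  (g.sharp x).toLinearMap ∘ₗ g.ricciTensor x

lemma inner_ricciOperator (x : G) (v w : TangentSpace 𝓘(ℝ, E) x) :
    g.inner x (g.ricciOperator x v) w = g.ricciTensor x v w :=
  g.inner_sharp x (g.ricciTensor x v) w

/-- The metric is flat if its curvature tensor vanishes identically. -/
def IsFlat : Prop := ∀ (x : G) (u v w : TangentSpace 𝓘(ℝ, E) x), g.curvature x u v w = 0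

end LeftInvariantMetric

end

end LeftInvariant

/-! ### Trace consequences of Lie's theorem for solvable Lie algebras. -/

section LieTheorem

open LieModule LieAlgebra TensorProduct

attribute [local instance] LieRing.ofAssociativeRing

/-! By left invariance everything reduces to algebra on the Lie algebra with its inner product; for
both claims it suffices that `c ≥ 0` forces zero Ricci tensor and zero curvature. Let `n` be the
space `traceKernel` of vectors whose `ad` has trace zero and which lie in the radical of the Killing
form, and let `a` be its orthogonal complement. Solvability puts all brackets and all values of
derivations in `n` (`LieDerivation.trace_ad_comp_ad_eq_zero`).

For `A` in `a`, the soliton equation at `(A, A)` loses its `D` term and reads `c|A|² = -¼|ad A + (ad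
A)ᵗ|²` (`norm_sq_of_mem_orthogonal`). If `c ≥ 0`, then `ad A` is skew and `c|A|² = 0`, so the
algebra is unimodular. Unimodularity gives `tr(Ric D) = 0`, hence `|Ric|² = c · scal`. This is zero
for `c = 0`; for `c > 0` one has `a = 0`, the Killing form vanishes and `scal ≤ 0`. So `Ric = 0`
(`ricci_eq_zero_of_nonneg`).

Once `Ric = 0`, skewness of `ad A` makes `a` abelian, and `scal = 0` makes `n` abelian. Then `∇`
vanishes along `n` and equals `ad` along `a`, so the metric is flat (`flat_of_ricci_eq_zero`). -/

theorem isNilpotent_toEnd_lie_mul_toEnd_of_isAlgClosed {K L : Type*} [Field K] [CharZero K]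
    [IsAlgClosed K] [LieRing L] [LieAlgebra K L] [LieAlgebra.IsSolvable L] (x y z : L) (n : ℕ) :
    ∀ (V : Type*) [AddCommGroup V] [Module K V] [LieRingModule L V] [LieModule K L V]
      [FiniteDimensional K V], Module.finrank K V = n →
      IsNilpotent (toEnd K L V ⁅x, y⁆ * toEnd K L V z) := by
  -- The module stays universally quantified because the induction passes to a quotient of `V` by a
  -- common eigenvector.
  induction n using Nat.strong_induction_on with
  | _ n ih =>
    intro V _ _ _ _ _ hn
    obtain _ | _ := subsingleton_or_nontrivial V
    · exact ⟨1, Subsingleton.elim _ _⟩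
    obtain ⟨χ, hχ⟩ := exists_nontrivial_weightSpace_of_isSolvable K L V
    obtain ⟨⟨v, hv⟩, hv0⟩ := exists_ne (0 : weightSpace V χ)
    rw [mem_weightSpace] at hv
    replace hv0 : v ≠ 0 := by simpa using hv0
    let N : LieSubmodule K L V :=
      { K ∙ v with
        lie_mem := by
          intro a m hm
          obtain ⟨t, rfl⟩ := Submodule.mem_span_singleton.1 hm
          rw [lie_smul, hv]
          exact Submodule.smul_mem _ _ (Submodule.smul_mem _ _ (Submodule.mem_span_singleton_self v)) }
    have hN : ∀ m ∈ N, ∃ t : K, t • v = m := fun m hm ↦ Submodule.mem_span_singleton.1 hm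
    have hvN : v ∈ N := Submodule.mem_span_singleton_self v
    have hlt : Module.finrank K (V ⧸ N.toSubmodule) < n := by
      have h1 := Submodule.finrank_quotient_add_finrank N.toSubmodule
      have h2 : Module.finrank K N.toSubmodule = 1 := finrank_span_singleton hv0
      lia
    obtain ⟨k, hk⟩ := ih _ hlt (V ⧸ N) rfl
    set T := toEnd K L V ⁅x, y⁆ * toEnd K L V z with hT
    have hq : ∀ (j : ℕ) (w : V), (LieSubmodule.Quotient.mk ((T ^ j) w) : V ⧸ N) =
        ((toEnd K L (V ⧸ N) ⁅x, y⁆ * toEnd K L (V ⧸ N) z) ^ j) (LieSubmodule.Quotient.mk w) := by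
      intro j w
      induction j with
      | zero => rfl
      | succ j ihj =>
        rw [pow_succ', pow_succ', Module.End.mul_apply, Module.End.mul_apply _ (_ ^ j), ← ihj]
        rfl
    -- `T ^ k` maps into the line `N`, on which `⁅x, y⁆` acts by a commutator of scalars, hence by
    -- zero; one more factor `T` kills it.
    refine ⟨k + 1, LinearMap.ext fun w ↦ ?_⟩
    have hw : (T ^ k) w ∈ N := by
      refine (LieSubmodule.Quotient.mk_eq_zero N).1 ((hq k w).trans ?_)
      rw [hk]; rfl
    obtain ⟨t, ht⟩ := hN _ hw
    rw [pow_succ', Module.End.mul_apply, ← ht, map_smul, hT, Module.End.mul_apply]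
    have hxy : χ ⁅x, y⁆ • v = 0 := by
      rw [← hv, lie_lie, hv, hv, lie_smul, lie_smul, hv, hv, smul_comm, sub_self]
    simp only [toEnd_apply_apply, hv, lie_smul, hxy, smul_zero, LinearMap.zero_apply]

/-- A common eigenvector may exist only after complexification; base change preserves the trace and
solvability. -/
theorem trace_toEnd_lie_mul_toEnd_of_isSolvable {L V : Type*} [LieRing L] [LieAlgebra ℝ L]
    [LieAlgebra.IsSolvable L] [AddCommGroup V] [Module ℝ V] [LieRingModule L V] [LieModule ℝ L V]
    [FiniteDimensional ℝ V] (x y z : L) :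
    LinearMap.trace ℝ V (toEnd ℝ L V ⁅x, y⁆ ∘ₗ toEnd ℝ L V z) = 0 := by
  suffices algebraMap ℝ ℂ (LinearMap.trace ℝ V (toEnd ℝ L V ⁅x, y⁆ ∘ₗ toEnd ℝ L V z)) = 0 by
    simpa using this
  rw [← LinearMap.trace_baseChange, LinearMap.baseChange_comp, ← toEnd_baseChange,
    ← toEnd_baseChange]
  have h := isNilpotent_toEnd_lie_mul_toEnd_of_isAlgClosed (K := ℂ) ((1 : ℂ) ⊗ₜ[ℝ] x) (1 ⊗ₜ y)
    (1 ⊗ₜ z) _ (ℂ ⊗[ℝ] V) rfl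
  rw [ExtendScalars.bracket_tmul, one_mul] at h
  exact (LinearMap.isNilpotent_trace_of_isNilpotent h).eq_zero

variable {S : Type*} [LieRing S] [LieAlgebra ℝ S]

/-- The homomorphism from the one-dimensional Lie algebra sending `1` to a given derivation. -/
def LieDerivation.toLieHom (D : LieDerivation ℝ S S) : ℝ →ₗ⁅ℝ⁆ LieDerivation ℝ S S :=
  { LinearMap.toSpanSingleton ℝ _ D with
    map_lie' := by
      intro s t
      simp [LieRing.of_associative_ring_bracket, mul_comm s t] }

theorem LieDerivation.toLieHom_apply (D : LieDerivation ℝ S S) (t : ℝ) (x : S) :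
    D.toLieHom t x = t • D x := rfl

/-- The kernel of the projection to `ℝ` embeds in `S`, and it contains all commutators since `ℝ` is
abelian. -/
instance LieDerivation.isSolvable_semiDirectSum [LieAlgebra.IsSolvable S]
    (D : LieDerivation ℝ S S) : LieAlgebra.IsSolvable (S ⋊⁅D.toLieHom⁆ ℝ) := by
  let I : LieIdeal ℝ (S ⋊⁅D.toLieHom⁆ ℝ) := (SemiDirectSum.projr D.toLieHom).ker
  have hI : ∀ x, x ∈ I ↔ x.right = 0 := fun x ↦ LieHom.mem_ker
  let f : I →ₗ⁅ℝ⁆ S :=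
    { toFun := fun x ↦ x.1.left
      map_add' := fun _ _ ↦ rfl
      map_smul' := fun _ _ ↦ rfl
      map_lie' := by
        rintro ⟨x, hx⟩ ⟨y, hy⟩
        rw [hI] at hx hy
        simp [hx, hy] }
  have hf : Function.Injective f := by
    rintro ⟨x, hx⟩ ⟨y, hy⟩ h
    rw [hI] at hx hy
    exact Subtype.ext (SemiDirectSum.ext h (hx.trans hy.symm))
  have hsol : LieAlgebra.IsSolvable I := hf.lieAlgebra_isSolvable
  obtain ⟨k, hk⟩ := IsSolvable.solvable (R := ℝ) (L := I)
  rw [LieIdeal.derivedSeries_eq_bot_iff] at hk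
  have h1 : derivedSeriesOfIdeal ℝ (S ⋊⁅D.toLieHom⁆ ℝ) 1 ⊤ ≤ I := by
    rw [derivedSeriesOfIdeal_succ, derivedSeriesOfIdeal_zero, LieSubmodule.lie_le_iff]
    intro x _ y _
    rw [hI]
    simp [LieRing.of_associative_ring_bracket, mul_comm]
  refine IsSolvable.mk (R := ℝ) (k := k + 1) ?_
  rw [derivedSeries_def, derivedSeriesOfIdeal_add, eq_bot_iff, ← hk]
  exact derivedSeriesOfIdeal_mono h1 k

/-- This is the adjoint action of the extension on its ideal `S`: the generator of `ℝ` acts as `D`.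
-/
instance LieDerivation.semiDirectSumLieRingModule (D : LieDerivation ℝ S S) :
    LieRingModule (S ⋊⁅D.toLieHom⁆ ℝ) S where
  bracket x s := ⁅x.left, s⁆ + x.right • D s
  add_lie x y s := by simp [add_smul]; abel
  lie_add x s t := by simp; abel
  leibniz_lie x y s := by
    simp only [SemiDirectSum.lie_eq_mk, LieDerivation.toLieHom_apply, sub_lie, add_lie, smul_lie,
      lie_lie, LieRing.of_associative_ring_bracket, mul_comm, sub_self, zero_smul, lie_add,
      lie_smul, map_add, map_smul, LieDerivation.apply_lie_eq_add, smul_add, add_zero]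
    module

theorem LieDerivation.semiDirectSum_lie (D : LieDerivation ℝ S S) (x : S ⋊⁅D.toLieHom⁆ ℝ)
    (s : S) : ⁅x, s⁆ = ⁅x.left, s⁆ + x.right • D s := rfl

instance LieDerivation.semiDirectSumLieModule (D : LieDerivation ℝ S S) :
    LieModule ℝ (S ⋊⁅D.toLieHom⁆ ℝ) S where
  smul_lie t x s := by simp [LieDerivation.semiDirectSum_lie, mul_smul]
  lie_smul t x s := by simp [LieDerivation.semiDirectSum_lie, smul_comm t]

/-- In the solvable extension of `S` by `D`, the vector `D x` is the commutator of the generator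
with `x`, so the trace identity for commutators applies. -/
theorem LieDerivation.trace_ad_comp_ad_eq_zero [LieAlgebra.IsSolvable S] [FiniteDimensional ℝ S]
    (D : LieDerivation ℝ S S) (x y : S) :
    LinearMap.trace ℝ S (toEnd ℝ S S (D x) ∘ₗ toEnd ℝ S S y) = 0 := by
  have h := trace_toEnd_lie_mul_toEnd_of_isSolvable (V := S) (SemiDirectSum.inr D.toLieHom 1)
    (SemiDirectSum.inl D.toLieHom x) (SemiDirectSum.inl D.toLieHom y)
  convert h using 3
  · ext s
    simp [LieDerivation.semiDirectSum_lie, LieDerivation.toLieHom_apply]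
  · ext s
    simp [LieDerivation.semiDirectSum_lie]

end LieTheorem

/-! ### Metric Lie algebras, given by a bracket `b` on an inner product space -/

namespace MetricLieBracket

open LinearMap
open scoped InnerProductSpace

theorem trace_adjoint_eq {V : Type*} [NormedAddCommGroup V] [InnerProductSpace ℝ V]
    [FiniteDimensional ℝ V] (T : V →ₗ[ℝ] V) : trace ℝ V (adjoint T) = trace ℝ V T := by
  rw [trace_eq_sum_inner _ (stdOrthonormalBasis ℝ V), trace_eq_sum_inner _ (stdOrthonormalBasis ℝ V)]
  refine Finset.sum_congr rfl fun i _ ↦ ?_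
  rw [adjoint_inner_right, real_inner_comm]

theorem trace_adjoint_comp {V ι : Type*} [NormedAddCommGroup V] [InnerProductSpace ℝ V]
    [FiniteDimensional ℝ V] [Fintype ι] (e : OrthonormalBasis ι ℝ V) (S T : V →ₗ[ℝ] V) :
    trace ℝ V (adjoint S ∘ₗ T) = ∑ i, ⟪S (e i), T (e i)⟫_ℝ := by
  rw [trace_eq_sum_inner _ e]
  exact Finset.sum_congr rfl fun i _ ↦ adjoint_inner_right _ _ _

theorem trace_comp_eq_zero_of_adjoint {V : Type*} [NormedAddCommGroup V] [InnerProductSpace ℝ V]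
    [FiniteDimensional ℝ V] {S J : V →ₗ[ℝ] V} (hS : adjoint S = S) (hJ : adjoint J = -J) :
    trace ℝ V (J ∘ₗ S) = 0 := by
  have h := trace_adjoint_eq (J ∘ₗ S)
  rw [adjoint_comp, hS, hJ, comp_neg, map_neg, trace_comp_comm'] at h
  linarith

variable {V : Type*} [NormedAddCommGroup V] [InnerProductSpace ℝ V]

/-- The Ricci tensor of a connection `N` with respect to a bracket `b`: the trace of
`u ↦ N u (N v w) - N v (N u w) - N (b u v) w`, for a skew-symmetric `b`. -/
noncomputable def ricci (b N : V →ₗ[ℝ] V →ₗ[ℝ] V) (v w : V) : ℝ :=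
  trace ℝ V (N.flip (N v w) - N v ∘ₗ N.flip w + N.flip w ∘ₗ b v)

/-- `N` satisfies the Koszul formula for the bracket `b`. -/
def IsKoszul (b N : V →ₗ[ℝ] V →ₗ[ℝ] V) : Prop :=
  ∀ x y z, ⟪N x y, z⟫_ℝ = (1 / 2 : ℝ) * (⟪b x y, z⟫_ℝ - ⟪b y z, x⟫_ℝ + ⟪b z x, y⟫_ℝ)

/-- The vectors on which the trace of `b` and the Killing form of `b` vanish. -/
noncomputable def traceKernel (b : V →ₗ[ℝ] V →ₗ[ℝ] V) : Submodule ℝ V where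
  carrier := {x | trace ℝ V (b x) = 0 ∧ ∀ y, trace ℝ V (b x ∘ₗ b y) = 0}
  add_mem' := by
    rintro x y ⟨hx, hx'⟩ ⟨hy, hy'⟩
    refine ⟨by simp [hx, hy], fun z ↦ ?_⟩
    rw [map_add, add_comp, map_add, hx', hy', add_zero]
  zero_mem' := by simp
  smul_mem' := by
    rintro c x ⟨hx, hx'⟩
    refine ⟨by simp [hx], fun z ↦ ?_⟩
    rw [map_smul, smul_comp, map_smul, hx', smul_zero]

theorem mem_traceKernel {b : V →ₗ[ℝ] V →ₗ[ℝ] V} {x : V} : x ∈ traceKernel b ↔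
    trace ℝ V (b x) = 0 ∧ ∀ y, trace ℝ V (b x ∘ₗ b y) = 0 := Iff.rfl

variable {b N : V →ₗ[ℝ] V →ₗ[ℝ] V}

theorem bracket_self (hb : ∀ x y, b x y = -b y x) (x : V) : b x x = 0 := by
  have h := hb x x
  rw [eq_neg_iff_add_eq_zero, ← two_smul ℝ] at h
  simpa using h

theorem apply_eq_add_flip (hb : ∀ x y, b x y = -b y x) (hN : IsKoszul b N) (v : V) :
    N v = b v + N.flip v := by
  ext u
  refine ext_inner_right ℝ fun z ↦ ?_
  rw [LinearMap.add_apply, inner_add_left, flip_apply, hN, hN, hb u v, hb u z, hb z v]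
  simp only [inner_neg_left]
  ring

/-! ### The Ricci tensor of a metric Lie algebra. -/

variable [FiniteDimensional ℝ V]
  {ι : Type*} [Fintype ι] (e : OrthonormalBasis ι ℝ V)

theorem trace_flip_eq (hb : ∀ x y, b x y = -b y x) (hN : IsKoszul b N) (u : V) :
    trace ℝ V (N.flip u) = -trace ℝ V (b u) := by
  rw [trace_eq_sum_inner _ (stdOrthonormalBasis ℝ V), trace_eq_sum_inner _ (stdOrthonormalBasis ℝ V),
    ← Finset.sum_neg_distrib]
  refine Finset.sum_congr rfl fun i _ ↦ ?_
  rw [real_inner_comm, flip_apply, hN, bracket_self hb, hb _ u, inner_neg_left, inner_zero_left,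
    real_inner_comm]
  ring

/-- Torsion-freeness reduces the Ricci trace to `-tr b (N v w) - tr (N.flip v ∘ N.flip w)`.
Splitting each `N.flip x` into symmetric and skew parts kills the mixed traces; the squares of the
parts give the remaining sums. -/
theorem ricci_eq (hb : ∀ x y, b x y = -b y x) (hN : IsKoszul b N) (v w : V) :
    ricci b N v w = -trace ℝ V (b (N v w)) - (1 / 2) * ∑ i, ⟪b v (e i), b w (e i)⟫_ℝ
      - (1 / 2) * trace ℝ V (b v ∘ₗ b w)
      + (1 / 4) * ∑ i, ∑ j, ⟪b (e i) (e j), v⟫_ℝ * ⟪b (e i) (e j), w⟫_ℝ := by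
  -- By Koszul, `-S x / 2` and `J x / 2` are the symmetric and skew parts of `N.flip x`.
  let S : V → V →ₗ[ℝ] V := fun x ↦ b x + adjoint (b x)
  let J : V → V →ₗ[ℝ] V := fun x ↦ (2 : ℝ) • N.flip x + S x
  have hJ : ∀ x u z, ⟪J x u, z⟫_ℝ = ⟪b z u, x⟫_ℝ := by
    intro x u z
    simp only [J, S, LinearMap.add_apply, LinearMap.smul_apply, inner_add_left, inner_smul_left,
      adjoint_inner_left, flip_apply]
    rw [hN, hb u x, real_inner_comm (b x z)]
    simp only [inner_neg_left, conj_trivial]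
    ring
  have hS : ∀ x, adjoint (S x) = S x := fun x ↦ by
    simp only [S, map_add, adjoint_adjoint]; abel
  have hJa : ∀ x, adjoint (J x) = -J x := by
    intro x
    ext u
    refine ext_inner_right ℝ fun z ↦ ?_
    rw [adjoint_inner_left, LinearMap.neg_apply, inner_neg_left, hJ, real_inner_comm, hJ, hb,
      inner_neg_left]
  have hNJ : ∀ x, N.flip x = (1 / 2 : ℝ) • (J x - S x) := by
    intro x; simp only [J]; module
  have h1 : trace ℝ V (J v ∘ₗ S w) = 0 := trace_comp_eq_zero_of_adjoint (hS w) (hJa v)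
  have h2 : trace ℝ V (S v ∘ₗ J w) = 0 := by
    rw [trace_comp_comm']; exact trace_comp_eq_zero_of_adjoint (hS v) (hJa w)
  have h3 : trace ℝ V (J v ∘ₗ J w) =
      -∑ i, ∑ j, ⟪b (e i) (e j), v⟫_ℝ * ⟪b (e i) (e j), w⟫_ℝ := by
    have : J v ∘ₗ J w = -(adjoint (J v) ∘ₗ J w) := by rw [hJa, neg_comp, neg_neg]
    rw [this, map_neg, trace_adjoint_comp e, Finset.sum_comm]
    congr 1
    refine Finset.sum_congr rfl fun i _ ↦ ?_
    rw [← e.sum_inner_mul_inner]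
    refine Finset.sum_congr rfl fun j _ ↦ ?_
    rw [hJ, real_inner_comm (J w _), hJ]
  have h4 : trace ℝ V (S v ∘ₗ S w) =
      2 * trace ℝ V (b v ∘ₗ b w) + 2 * ∑ i, ⟪b v (e i), b w (e i)⟫_ℝ := by
    have h5 : trace ℝ V (b v ∘ₗ adjoint (b w)) = trace ℝ V (adjoint (b v) ∘ₗ b w) := by
      rw [← trace_adjoint_eq, adjoint_comp, adjoint_adjoint, trace_comp_comm']
    have h6 : trace ℝ V (adjoint (b v) ∘ₗ adjoint (b w)) = trace ℝ V (b v ∘ₗ b w) := by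
      rw [← adjoint_comp, trace_adjoint_eq, trace_comp_comm']
    simp only [S, add_comp, comp_add, map_add]
    rw [h5, h6, trace_adjoint_comp e]
    ring
  have h7 : ricci b N v w = -trace ℝ V (b (N v w)) - trace ℝ V (N.flip v ∘ₗ N.flip w) := by
    rw [ricci, map_add, map_sub, trace_flip_eq hb hN, trace_comp_comm' (N.flip w),
      show N v = b v + N.flip v from apply_eq_add_flip hb hN v, comp_add, map_add,
      trace_comp_comm' (N.flip w) (N.flip v)]
    ring
  rw [h7, hNJ v, hNJ w]
  simp only [smul_comp, comp_smul, sub_comp, comp_sub, map_smul, map_sub, smul_eq_mul]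
  rw [h1, h2, h3, h4]
  ring

theorem trace_bracket_eq_zero (hjac : ∀ x y z, b (b x y) z = b x (b y z) - b y (b x z)) (x y : V) :
    trace ℝ V (b (b x y)) = 0 := by
  have : b (b x y) = b x ∘ₗ b y - b y ∘ₗ b x := by ext z; simp [hjac]
  rw [this, map_sub, trace_comp_comm', sub_self]

theorem trace_derivation_eq_zero {D : V →ₗ[ℝ] V}
    (hD : ∀ x y, D (b x y) = b (D x) y + b x (D y)) (x : V) : trace ℝ V (b (D x)) = 0 := by
  have : b (D x) = D ∘ₗ b x - b x ∘ₗ D := by ext z; simp [hD]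
  rw [this, map_sub, trace_comp_comm', sub_self]

/-- Solvability of the bracket enters only through Cartan's criterion, expressed by `bracket_mem`. -/
structure IsSolvableBracket (b : V →ₗ[ℝ] V →ₗ[ℝ] V) : Prop where
  skew : ∀ x y, b x y = -b y x
  jacobi : ∀ x y z, b (b x y) z = b x (b y z) - b y (b x z)
  bracket_mem : ∀ x y, b x y ∈ traceKernel b

/-! ### Solitons with nonnegative constant are Ricci flat. -/

section Soliton

variable {c : ℝ} {D : V →ₗ[ℝ] V}

/-- Brackets and `D A` lie in `traceKernel b`, hence are orthogonal to `A`; what survives of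
`ricci_eq` at `(A, A)` is a multiple of the squared norm of `b A + adjoint (b A)`. -/
theorem norm_sq_of_mem_orthogonal (hb : IsSolvableBracket b) (hN : IsKoszul b N)
    (hDn : ∀ x, D x ∈ traceKernel b)
    (hric : ∀ v w, ricci b N v w = c * ⟪v, w⟫_ℝ + ⟪D v, w⟫_ℝ) {A : V}
    (hA : A ∈ (traceKernel b)ᗮ) :
    c * ⟪A, A⟫_ℝ = -(1 / 4) * ∑ i, ⟪(b A + adjoint (b A)) (e i), (b A + adjoint (b A)) (e i)⟫_ℝ := by
  have hbr : ∀ x y, ⟪b x y, A⟫_ℝ = 0 := fun x y ↦ hA _ (hb.bracket_mem x y)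
  have h0 : trace ℝ V (b (N A A)) = 0 := by
    -- The trace form is represented by a vector `H`; Koszul expresses `⟪N A A, H⟫` through brackets
    -- paired with `A`, plus `b A A = 0`.
    let τ : V →ₗ[ℝ] ℝ := trace ℝ V ∘ₗ b
    let H : V := (InnerProductSpace.toDual ℝ V).symm τ.toContinuousLinearMap
    have hH : ∀ x, ⟪H, x⟫_ℝ = trace ℝ V (b x) := fun x ↦ by
      simp [H, τ]
    rw [← hH, real_inner_comm, hN, hbr, hbr, bracket_self hb.skew, inner_zero_left]
    ring
  have h := hric A A
  rw [hA _ (hDn A), ricci_eq e hb.skew hN, h0] at h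
  simp only [hbr, mul_zero, Finset.sum_const_zero] at h
  have h1 : ∑ i, ⟪(b A + adjoint (b A)) (e i), (b A + adjoint (b A)) (e i)⟫_ℝ =
      2 * ∑ i, ⟪b A (e i), b A (e i)⟫_ℝ + 2 * trace ℝ V (b A ∘ₗ b A) := by
    rw [← trace_adjoint_comp e]
    have h5 : trace ℝ V (b A ∘ₗ adjoint (b A)) = trace ℝ V (adjoint (b A) ∘ₗ b A) := by
      rw [trace_comp_comm']
    have h6 : trace ℝ V (adjoint (b A) ∘ₗ adjoint (b A)) = trace ℝ V (b A ∘ₗ b A) := by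
      rw [← adjoint_comp, trace_adjoint_eq]
    simp only [map_add, adjoint_adjoint, add_comp, comp_add]
    rw [h5, h6, trace_adjoint_comp e]
    ring
  rw [h1]
  linarith

theorem skew_and_of_mem_orthogonal (hb : IsSolvableBracket b) (hN : IsKoszul b N)
    (hDn : ∀ x, D x ∈ traceKernel b)
    (hric : ∀ v w, ricci b N v w = c * ⟪v, w⟫_ℝ + ⟪D v, w⟫_ℝ) (hc : 0 ≤ c) {A : V}
    (hA : A ∈ (traceKernel b)ᗮ) :
    adjoint (b A) = -b A ∧ c * ⟪A, A⟫_ℝ = 0 := by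
  let e := stdOrthonormalBasis ℝ V
  have h := norm_sq_of_mem_orthogonal e hb hN hDn hric hA
  have h1 : 0 ≤ c * ⟪A, A⟫_ℝ := mul_nonneg hc real_inner_self_nonneg
  have h2 : ∀ i ∈ Finset.univ,
      0 ≤ ⟪(b A + adjoint (b A)) (e i), (b A + adjoint (b A)) (e i)⟫_ℝ :=
    fun i _ ↦ real_inner_self_nonneg
  have h3 := Finset.sum_nonneg h2
  have h4 : ∑ i, ⟪(b A + adjoint (b A)) (e i), (b A + adjoint (b A)) (e i)⟫_ℝ = 0 := by linarith
  refine ⟨?_, by rw [h, h4, mul_zero]⟩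
  rw [Finset.sum_eq_zero_iff_of_nonneg h2] at h4
  have h5 : b A + adjoint (b A) = 0 := e.toBasis.ext fun i ↦ by
    rw [e.coe_toBasis, LinearMap.zero_apply]
    exact inner_self_eq_zero.1 (h4 i (Finset.mem_univ i))
  exact (neg_eq_of_add_eq_zero_right h5).symm

theorem trace_eq_zero (hb : IsSolvableBracket b) (hN : IsKoszul b N)
    (hDn : ∀ x, D x ∈ traceKernel b)
    (hric : ∀ v w, ricci b N v w = c * ⟪v, w⟫_ℝ + ⟪D v, w⟫_ℝ) (hc : 0 ≤ c) (x : V) :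
    trace ℝ V (b x) = 0 := by
  obtain ⟨y, hy, z, hz, rfl⟩ := (traceKernel b).exists_add_mem_mem_orthogonal x
  have h := trace_adjoint_eq (b z)
  rw [(skew_and_of_mem_orthogonal hb hN hDn hric hc hz).1, map_neg] at h
  rw [map_add, map_add, hy.1]
  linarith

/-- This is `tr(Ric D) = 0`. The Killing and trace terms vanish; the other two cancel, because the
Leibniz rule and skew-symmetry turn the quarter-sum into twice a quarter of the sum weighted by one
half. -/
theorem sum_ricci_derivation (hb : IsSolvableBracket b) (hN : IsKoszul b N)
    (hDn : ∀ x, D x ∈ traceKernel b) (hD : ∀ x y, D (b x y) = b (D x) y + b x (D y))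
    (htr : ∀ x, trace ℝ V (b x) = 0) : ∑ k, ricci b N (e k) (D (e k)) = 0 := by
  have hK : ∀ v, trace ℝ V (b v ∘ₗ b (D v)) = 0 := fun v ↦ by
    rw [trace_comp_comm']; exact (hDn v).2 v
  simp only [ricci_eq e hb.skew hN, htr, hK, mul_zero, sub_zero, neg_zero, zero_sub]
  have h1 : ∑ k, ∑ i, ∑ j, ⟪b (e i) (e j), e k⟫_ℝ * ⟪b (e i) (e j), D (e k)⟫_ℝ =
      ∑ i, ∑ j, ⟪b (e i) (e j), D (b (e i) (e j))⟫_ℝ := by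
    rw [Finset.sum_comm]
    refine Finset.sum_congr rfl fun i _ ↦ ?_
    rw [Finset.sum_comm]
    refine Finset.sum_congr rfl fun j _ ↦ ?_
    conv_rhs => rw [← adjoint_inner_left, ← e.sum_inner_mul_inner]
    refine Finset.sum_congr rfl fun k _ ↦ ?_
    rw [adjoint_inner_left, real_inner_comm (e k)]
    ring
  have h2 : ∑ i, ∑ j, ⟪b (e i) (e j), D (b (e i) (e j))⟫_ℝ =
      2 * ∑ i, ∑ j, ⟪b (e i) (e j), b (D (e i)) (e j)⟫_ℝ := by
    simp only [hD, inner_add_right, Finset.sum_add_distrib]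
    have h3 : ∑ i, ∑ j, ⟪b (e i) (e j), b (e i) (D (e j))⟫_ℝ =
        ∑ i, ∑ j, ⟪b (e i) (e j), b (D (e i)) (e j)⟫_ℝ := by
      rw [Finset.sum_comm]
      refine Finset.sum_congr rfl fun i _ ↦ Finset.sum_congr rfl fun j _ ↦ ?_
      rw [hb.skew (e j) (e i), hb.skew (e j), inner_neg_neg]
    rw [h3]; ring
  rw [Finset.sum_add_distrib, Finset.sum_neg_distrib, ← Finset.mul_sum, ← Finset.mul_sum, h1, h2]
  ring

theorem sum_ricci_self (hb : IsSolvableBracket b) (hN : IsKoszul b N)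
    (htr : ∀ x, trace ℝ V (b x) = 0) :
    ∑ k, ricci b N (e k) (e k) = -(1 / 4) * ∑ i, ∑ j, ⟪b (e i) (e j), b (e i) (e j)⟫_ℝ
      - (1 / 2) * ∑ k, trace ℝ V (b (e k) ∘ₗ b (e k)) := by
  simp only [ricci_eq e hb.skew hN, htr, neg_zero, zero_sub]
  have h1 : ∑ k, ∑ i, ∑ j, ⟪b (e i) (e j), e k⟫_ℝ * ⟪b (e i) (e j), e k⟫_ℝ =
      ∑ i, ∑ j, ⟪b (e i) (e j), b (e i) (e j)⟫_ℝ := by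
    rw [Finset.sum_comm]
    refine Finset.sum_congr rfl fun i _ ↦ ?_
    rw [Finset.sum_comm]
    refine Finset.sum_congr rfl fun j _ ↦ ?_
    rw [← e.sum_inner_mul_inner (b (e i) (e j))]
    exact Finset.sum_congr rfl fun k _ ↦ by rw [real_inner_comm (e k)]
  rw [Finset.sum_add_distrib, Finset.sum_sub_distrib, Finset.sum_neg_distrib, ← Finset.mul_sum,
    ← Finset.mul_sum, ← Finset.mul_sum, h1]
  ring

theorem ricci_eq_zero_of_nonneg (hb : IsSolvableBracket b) (hN : IsKoszul b N)
    (hDn : ∀ x, D x ∈ traceKernel b) (hD : ∀ x y, D (b x y) = b (D x) y + b x (D y))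
    (hric : ∀ v w, ricci b N v w = c * ⟪v, w⟫_ℝ + ⟪D v, w⟫_ℝ) (hc : 0 ≤ c) (v w : V) :
    ricci b N v w = 0 := by
  let e := stdOrthonormalBasis ℝ V
  have htr := trace_eq_zero hb hN hDn hric hc
  -- For `c > 0` the complement of `traceKernel b` is zero, so the Killing form vanishes and only
  -- the nonpositive term of the scalar curvature remains.
  have h1 : c * ∑ k, ricci b N (e k) (e k) ≤ 0 := by
    rcases hc.eq_or_lt with rfl | hc'
    · simp
    have hbot : (traceKernel b)ᗮ = ⊥ := (Submodule.eq_bot_iff _).2 fun A hA ↦ by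
      have h2 := (skew_and_of_mem_orthogonal hb hN hDn hric hc hA).2
      simpa [hc'.ne'] using h2
    have hK : ∀ x, trace ℝ V (b x ∘ₗ b x) = 0 := fun x ↦ by
      have hx : x ∈ traceKernel b := by
        rw [(Submodule.orthogonal_eq_bot_iff).1 hbot]; trivial
      exact hx.2 x
    rw [sum_ricci_self e hb hN htr]
    simp only [hK, Finset.sum_const_zero, mul_zero, sub_zero]
    have : 0 ≤ ∑ i, ∑ j, ⟪b (e i) (e j), b (e i) (e j)⟫_ℝ :=
      Finset.sum_nonneg fun i _ ↦ Finset.sum_nonneg fun j _ ↦ real_inner_self_nonneg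
    nlinarith
  -- The left side is `|Ric|²`, since the Ricci operator is `c • id + D`; one factor is expanded.
  have h2 : ∑ k, ⟪c • e k + D (e k), c • e k + D (e k)⟫_ℝ =
      c * ∑ k, ricci b N (e k) (e k) + ∑ k, ricci b N (e k) (D (e k)) := by
    rw [Finset.mul_sum, ← Finset.sum_add_distrib]
    refine Finset.sum_congr rfl fun k _ ↦ ?_
    rw [hric, hric, inner_add_right, inner_add_left, inner_add_left]
    simp only [real_inner_smul_left, real_inner_smul_right]
    ring
  rw [sum_ricci_derivation e hb hN hDn hD htr, add_zero] at h2
  have h3 : ∀ k ∈ Finset.univ, 0 ≤ ⟪c • e k + D (e k), c • e k + D (e k)⟫_ℝ :=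
    fun k _ ↦ real_inner_self_nonneg
  have h4 := (Finset.sum_eq_zero_iff_of_nonneg h3).1
    (le_antisymm (h2.trans_le h1) (Finset.sum_nonneg h3))
  have h5 : c • LinearMap.id + D = 0 := e.toBasis.ext fun k ↦ by
    rw [e.coe_toBasis, LinearMap.zero_apply]
    exact inner_self_eq_zero.1 (h4 k (Finset.mem_univ k))
  have h6 := LinearMap.congr_fun h5 v
  rw [hric, ← real_inner_smul_left, ← inner_add_left]
  exact (congrArg (fun x ↦ ⟪x, w⟫_ℝ) h6).trans (inner_zero_left w)

end Soliton

/-! ### Ricci flat metrics on solvable Lie algebras are flat. -/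

section RicciFlat

/-- A Ricci flat metric is a soliton with `c = 0` and `D = 0`. -/
theorem adjoint_of_ricci_eq_zero (hb : IsSolvableBracket b) (hN : IsKoszul b N)
    (hric : ∀ v w, ricci b N v w = 0) {A : V} (hA : A ∈ (traceKernel b)ᗮ) :
    adjoint (b A) = -b A :=
  (skew_and_of_mem_orthogonal (c := 0) (D := 0) hb hN (by simp) (by simp [hric]) le_rfl hA).1

theorem inner_bracket_of_ricci_eq_zero (hb : IsSolvableBracket b) (hN : IsKoszul b N)
    (hric : ∀ v w, ricci b N v w = 0) {A : V} (hA : A ∈ (traceKernel b)ᗮ) (x y : V) :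
    ⟪b A x, y⟫_ℝ = -⟪b A y, x⟫_ℝ := by
  rw [real_inner_comm, ← adjoint_inner_left, adjoint_of_ricci_eq_zero hb hN hric hA,
    LinearMap.neg_apply, inner_neg_left]

theorem bracket_orthogonal_eq_zero (hb : IsSolvableBracket b) (hN : IsKoszul b N)
    (hric : ∀ v w, ricci b N v w = 0) {A A' : V} (hA : A ∈ (traceKernel b)ᗮ)
    (hA' : A' ∈ (traceKernel b)ᗮ) : b A A' = 0 := by
  rw [← inner_self_eq_zero (𝕜 := ℝ), inner_bracket_of_ricci_eq_zero hb hN hric hA,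
    hA' _ (hb.bracket_mem _ _), neg_zero]

/-- In an orthonormal basis adapted to `traceKernel b` and its complement, the mixed brackets in the
scalar curvature cancel against the Killing term, by skewness of `b A`. Then `scal = 0` leaves the
sum of squares of the brackets within `traceKernel b`. -/
theorem bracket_traceKernel_eq_zero (hb : IsSolvableBracket b) (hN : IsKoszul b N)
    (hric : ∀ v w, ricci b N v w = 0) {x y : V} (hx : x ∈ traceKernel b)
    (hy : y ∈ traceKernel b) : b x y = 0 := by
  let K := traceKernel b
  let f₁ := stdOrthonormalBasis ℝ K
  let f₂ := stdOrthonormalBasis ℝ Kᗮ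
  let f := (f₁.prod f₂).map K.orthogonalDecomposition.symm
  have hl : ∀ i, f (Sum.inl i) = f₁ i := fun i ↦ by simp [f]
  have hr : ∀ i, f (Sum.inr i) = f₂ i := fun i ↦ by simp [f]
  have htr := trace_eq_zero (c := 0) (D := 0) hb hN (by simp) (by simp [hric]) le_rfl
  have h := sum_ricci_self f hb hN htr
  have hK : ∀ j, trace ℝ V (b (f₂ j) ∘ₗ b (f₂ j)) =
      -∑ i, ⟪b (f₂ j) (f₁ i), b (f₂ j) (f₁ i)⟫_ℝ := by
    intro j
    have h1 : b (f₂ j : V) ∘ₗ b (f₂ j : V) = -(adjoint (b (f₂ j : V)) ∘ₗ b (f₂ j : V)) := by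
      rw [adjoint_of_ricci_eq_zero hb hN hric (f₂ j).2, neg_comp, neg_neg]
    rw [h1, map_neg, trace_adjoint_comp f, Fintype.sum_sum_type]
    simp only [hl, hr, bracket_orthogonal_eq_zero hb hN hric (f₂ _).2 (f₂ _).2, inner_zero_left,
      Finset.sum_const_zero, add_zero]
  have hK' : ∀ i, trace ℝ V (b (f₁ i) ∘ₗ b (f₁ i)) = 0 := fun i ↦ (f₁ i).2.2 _
  have hsw : ∑ i, ∑ j, ⟪b (f₁ i) (f₂ j), b (f₁ i) (f₂ j)⟫_ℝ =
      ∑ j, ∑ i, ⟪b (f₂ j) (f₁ i), b (f₂ j) (f₁ i)⟫_ℝ := by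
    rw [Finset.sum_comm]
    refine Finset.sum_congr rfl fun i _ ↦ Finset.sum_congr rfl fun j _ ↦ ?_
    rw [hb.skew, inner_neg_neg]
  simp only [hric, Fintype.sum_sum_type, hl, hr, hK, hK', Finset.sum_const_zero,
    bracket_orthogonal_eq_zero hb hN hric (f₂ _).2 (f₂ _).2, inner_zero_left, add_zero, zero_add,
    Finset.sum_add_distrib, hsw, Finset.sum_neg_distrib] at h
  have h0 : ∑ i, ∑ j, ⟪b (f₁ i) (f₁ j), b (f₁ i) (f₁ j)⟫_ℝ = 0 := by linarith
  have h1 : ∀ i j, b (f₁ i) (f₁ j) = 0 := by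
    intro i j
    rw [Finset.sum_eq_zero_iff_of_nonneg
      fun i _ ↦ Finset.sum_nonneg fun j _ ↦ real_inner_self_nonneg] at h0
    have h2 := h0 i (Finset.mem_univ i)
    rw [Finset.sum_eq_zero_iff_of_nonneg fun j _ ↦ real_inner_self_nonneg] at h2
    exact inner_self_eq_zero.1 (h2 j (Finset.mem_univ j))
  have h2 : (b.compl₁₂ K.subtype K.subtype) = 0 :=
    LinearMap.ext_basis f₁.toBasis f₁.toBasis fun i j ↦ by simpa using h1 i j
  simpa using LinearMap.congr_fun₂ h2 ⟨x, hx⟩ ⟨y, hy⟩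

/-- After decomposing `y` and `z`, only brackets between the two summands survive in Koszul, and
they cancel in pairs by skewness of `b y₂` and `b z₂`. -/
theorem connection_eq_zero_of_mem_traceKernel (hb : IsSolvableBracket b) (hN : IsKoszul b N)
    (hric : ∀ v w, ricci b N v w = 0) {x : V} (hx : x ∈ traceKernel b) : N x = 0 := by
  ext y
  refine ext_inner_right ℝ fun z ↦ ?_
  obtain ⟨y₁, hy₁, y₂, hy₂, rfl⟩ := (traceKernel b).exists_add_mem_mem_orthogonal y
  obtain ⟨z₁, hz₁, z₂, hz₂, rfl⟩ := (traceKernel b).exists_add_mem_mem_orthogonal z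
  have h0 : ∀ {u v}, u ∈ traceKernel b → v ∈ traceKernel b → b u v = 0 :=
    bracket_traceKernel_eq_zero hb hN hric
  have h1 : ∀ u v w, w ∈ (traceKernel b)ᗮ → ⟪b u v, w⟫_ℝ = 0 :=
    fun u v w hw ↦ hw _ (hb.bracket_mem u v)
  rw [hN]
  simp only [map_add, LinearMap.add_apply, inner_add_left, inner_add_right, h0 hx hy₁,
    h0 hy₁ hz₁, h0 hz₁ hx, bracket_orthogonal_eq_zero hb hN hric hy₂ hz₂, h1 _ _ _ hy₂,
    h1 _ _ _ hz₂, inner_zero_left, LinearMap.zero_apply]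
  rw [hb.skew x y₂, hb.skew y₁ z₂]
  have h2 := inner_bracket_of_ricci_eq_zero hb hN hric hy₂ x z₁
  have h3 := inner_bracket_of_ricci_eq_zero hb hN hric hz₂ x y₁
  simp only [inner_neg_left]
  linarith

theorem connection_eq_bracket_of_mem_orthogonal (hb : IsSolvableBracket b) (hN : IsKoszul b N)
    (hric : ∀ v w, ricci b N v w = 0) {A : V} (hA : A ∈ (traceKernel b)ᗮ) : N A = b A := by
  ext y
  refine ext_inner_right ℝ fun z ↦ ?_
  rw [hN, hA _ (hb.bracket_mem _ _), hb.skew z A, inner_neg_left,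
    inner_bracket_of_ricci_eq_zero hb hN hric hA z y]
  ring

/-- `N` vanishes on brackets and on the `traceKernel b` parts. The commutator of `b u₂` and `b v₂`
is `b (b u₂ v₂)` by Jacobi, which is zero as the complement is abelian. -/
theorem flat_of_ricci_eq_zero (hb : IsSolvableBracket b) (hN : IsKoszul b N)
    (hric : ∀ v w, ricci b N v w = 0) (u v w : V) :
    N u (N v w) - N v (N u w) - N (b u v) w = 0 := by
  obtain ⟨u₁, hu₁, u₂, hu₂, rfl⟩ := (traceKernel b).exists_add_mem_mem_orthogonal u
  obtain ⟨v₁, hv₁, v₂, hv₂, rfl⟩ := (traceKernel b).exists_add_mem_mem_orthogonal v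
  rw [connection_eq_zero_of_mem_traceKernel hb hN hric (hb.bracket_mem _ _)]
  simp only [map_add, connection_eq_zero_of_mem_traceKernel hb hN hric hu₁,
    connection_eq_zero_of_mem_traceKernel hb hN hric hv₁,
    connection_eq_bracket_of_mem_orthogonal hb hN hric hu₂,
    connection_eq_bracket_of_mem_orthogonal hb hN hric hv₂, zero_add, LinearMap.zero_apply,
    sub_zero, ← hb.jacobi, bracket_orthogonal_eq_zero hb hN hric hu₂ hv₂, map_zero]

end RicciFlat

end MetricLieBracket

/-- A soliton inner product with nonnegative constant on a solvable Lie algebra is Ricci flat and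
flat. The curvature quantities are those of the bilinear map `N` given by the Koszul formula. -/
theorem LieAlgebra.IsSolvable.ricci_eq_zero_and_flat_of_soliton {L : Type*} [LieRing L]
    [LieAlgebra ℝ L] [FiniteDimensional ℝ L] [LieAlgebra.IsSolvable L]
    (B : L →ₗ[ℝ] L →ₗ[ℝ] ℝ) (hB : ∀ x y, B x y = B y x) (hpos : ∀ x, x ≠ 0 → 0 < B x x)
    (N : L →ₗ[ℝ] L →ₗ[ℝ] L)
    (hN : ∀ x y z, B (N x y) z = (1 / 2 : ℝ) * (B ⁅x, y⁆ z - B ⁅y, z⁆ x + B ⁅z, x⁆ y))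
    (c : ℝ) (hc : 0 ≤ c) (D : LieDerivation ℝ L L)
    (hric : ∀ v w, LinearMap.trace ℝ L (N.flip (N v w) - N v ∘ₗ N.flip w +
      N.flip w ∘ₗ LieModule.toEnd ℝ L L v) = c * B v w + B (D v) w) :
    (∀ v w, LinearMap.trace ℝ L (N.flip (N v w) - N v ∘ₗ N.flip w +
      N.flip w ∘ₗ LieModule.toEnd ℝ L L v) = 0) ∧
    ∀ u v w, N u (N v w) - N v (N u w) - N ⁅u, v⁆ w = 0 := by
  have had : ∀ x y : L, LieDerivation.ad ℝ L x y = ⁅x, y⁆ := fun x y ↦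
    LinearMap.congr_fun (LieDerivation.coe_ad_apply_eq_ad_apply x) y
  let core : InnerProductSpace.Core ℝ L :=
    { inner := fun x y ↦ B x y
      conj_inner_symm := fun x y ↦ by simp [hB x y]
      re_inner_nonneg := fun x ↦ by
        by_cases hx : x = 0
        · simp [hx]
        · exact (hpos x hx).le
      definite := fun x hx ↦ by
        by_contra h
        exact (hpos x h).ne' hx
      add_left := fun x y z ↦ by simp
      smul_left := fun x y r ↦ by simp }
  let _ : NormedAddCommGroup L := core.toNormedAddCommGroup
  let _ : InnerProductSpace ℝ L := InnerProductSpace.ofCore core.toCore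
  let b : L →ₗ[ℝ] L →ₗ[ℝ] L := (LieModule.toEnd ℝ L L : L →ₗ[ℝ] Module.End ℝ L)
  have hDn : ∀ (D : LieDerivation ℝ L L) x, D x ∈ MetricLieBracket.traceKernel b := fun D x ↦
    ⟨MetricLieBracket.trace_derivation_eq_zero (b := b) (D := D)
      (fun x y ↦ (D.apply_lie_eq_add x y).trans (add_comm _ _)) x,
      fun y ↦ D.trace_ad_comp_ad_eq_zero x y⟩
  have hb : MetricLieBracket.IsSolvableBracket b :=
    { skew := fun x y ↦ (lie_skew x y).symm
      jacobi := fun x y z ↦ lie_lie x y z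
      bracket_mem := fun x y ↦ by
        -- A bracket is a value of an inner derivation, so the statement for derivations covers it.
        rw [show b x y = LieDerivation.ad ℝ L x y from (had x y).symm]
        exact hDn (LieDerivation.ad ℝ L x) y }
  have hK : MetricLieBracket.IsKoszul b N := hN
  have h0 : ∀ v w, MetricLieBracket.ricci b N v w = 0 :=
    MetricLieBracket.ricci_eq_zero_of_nonneg (D := D) hb hK (hDn D)
      (fun x y ↦ (D.apply_lie_eq_add x y).trans (add_comm _ _)) hric hc
  exact ⟨h0, MetricLieBracket.flat_of_ricci_eq_zero hb hK h0⟩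

/-! ### Transport from the Lie algebra to the group. -/

namespace LeftInvariant

namespace LeftInvariantMetric

variable {E : Type*} [NormedAddCommGroup E] [NormedSpace ℝ E]
  {G : Type*} [TopologicalSpace G] [ChartedSpace E G] [Group G]

theorem fromIdentity_one (v : GroupLieAlgebra 𝓘(ℝ, E) G) : fromIdentity (E := E) (1 : G) v = v := by
  have h : ((1 : G) * ·) = id := funext one_mul
  unfold fromIdentity
  rw [h]
  simp

variable [LieGroup 𝓘(ℝ, E) ∞ G]

theorem toIdentity_one (v : GroupLieAlgebra 𝓘(ℝ, E) G) : toIdentity (E := E) (1 : G) v = v := by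
  conv_lhs => rw [← fromIdentity_one v]
  exact toIdentity_fromIdentity _ _

theorem ricciTensor_eq [FiniteDimensional ℝ E] (g : LeftInvariantMetric E G) (x : G) (v w : TangentSpace 𝓘(ℝ, E) x) :
    g.ricciTensor x v w = LinearMap.trace ℝ (GroupLieAlgebra 𝓘(ℝ, E) G)
      (g.nabla.flip (g.nabla (toIdentity x v) (toIdentity x w)) -
        g.nabla (toIdentity x v) ∘ₗ g.nabla.flip (toIdentity x w) +
        g.nabla.flip (toIdentity x w) ∘ₗ
          LieModule.toEnd ℝ (GroupLieAlgebra 𝓘(ℝ, E) G) (GroupLieAlgebra 𝓘(ℝ, E) G)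
            (toIdentity x v)) := by
  let φ : TangentSpace 𝓘(ℝ, E) x ≃ₗ[ℝ] GroupLieAlgebra 𝓘(ℝ, E) G :=
    { (toIdentity (E := E) x).toLinearMap with
      invFun := fromIdentity x
      left_inv := fromIdentity_toIdentity x
      right_inv := toIdentity_fromIdentity x }
  change LinearMap.trace ℝ _ (g.curvatureEnd x v w) = _
  rw [← LinearMap.trace_conj' (g.curvatureEnd x v w) φ]
  congr 1
  ext u
  rw [LinearEquiv.conj_apply_apply]
  change toIdentity x (g.curvature x (fromIdentity x u) v w) = _
  -- Reversing the bracket turns `-∇_[u,v] w` into `+∇_[v,u] w`, a composite with `ad v`.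
  rw [curvature_eq, toIdentity_fromIdentity, toIdentity_fromIdentity, ← lie_skew]
  simp only [map_neg, LinearMap.neg_apply, sub_neg_eq_add]
  rfl

end LeftInvariantMetric

end LeftInvariant

theorem proposition4p2
    {E : Type*} [NormedAddCommGroup E] [NormedSpace ℝ E] [FiniteDimensional ℝ E]
    {G : Type*} [TopologicalSpace G] [ChartedSpace E G] [Group G] [LieGroup 𝓘(ℝ, E) ∞ G]
    [SimplyConnectedSpace G] [LieAlgebra.IsSolvable (GroupLieAlgebra 𝓘(ℝ, E) G)]
    (g : LeftInvariant.LeftInvariantMetric E G) (c : ℝ)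
    (D : LieDerivation ℝ (GroupLieAlgebra 𝓘(ℝ, E) G) (GroupLieAlgebra 𝓘(ℝ, E) G))
    (hRic : g.ricciOperator 1 = c • LinearMap.id + D.toLinearMap) :
    (0 ≤ c → ∀ x : G, g.ricciOperator x = 0) ∧ (¬ g.IsFlat → c < 0) := by
  have key := fun hc : 0 ≤ c ↦
    LieAlgebra.IsSolvable.ricci_eq_zero_and_flat_of_soliton (L := GroupLieAlgebra 𝓘(ℝ, E) G)
      (g.form 1) (g.symm 1) (g.pos 1) g.nabla g.inner_nabla c hc D (fun v w ↦ by
        have h := g.ricciTensor_eq 1 v w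
        rw [LeftInvariant.LeftInvariantMetric.toIdentity_one,
          LeftInvariant.LeftInvariantMetric.toIdentity_one] at h
        rw [← h, ← g.inner_ricciOperator, hRic]
        simp)
  refine ⟨fun hc x ↦ ?_, fun hflat ↦ ?_⟩
  · refine LinearMap.ext fun v ↦ g.ext_inner fun w ↦ ?_
    rw [g.inner_ricciOperator, g.ricciTensor_eq, (key hc).1]
    simp
  · by_contra! hc
    refine hflat fun x u v w ↦ ?_
    rw [g.curvature_eq, (key hc).2, map_zero]
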